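/- Let $R$ be an associative ring with identity; modules are left $R$-modules. For $n\in\{0,1,2,\dots\}\cup\{\infty\}$ (with $\infty+1=\infty$) let $\mathcal P^{<n+1}$ be the class of modules $M$ having an exact sequence $0\to P_k\to\cdots\to P_0\to M\to 0$ with all $P_i$ finitely generated projective and $k<n+1$. Let $\mathrm{l.fPD}(R)$ be the supremum of the projective dimensions of all modules in $\mathcal P^{<\infty}$. A short exact sequence $0\to A\to B\to C\to 0$ of modules is $n$-exact if $0\to \mathrm{Hom}_R(M,A)\to \mathrm{Hom}_R(M,B)\to \mathrm{Hom}_R(M,C)\to 0$ is exact for every $M\in\mathcal P^{<n+1}$. A complex $X^\bullet$ is $n$-exact if for every $i\in\mathbb Z$ the sequence $0\to \mathrm{Ker}(d^i)\to X^i\to \mathrm{Coker}(d^{i-1})\to 0$ is an $n$-exact short exact sequence. For $\ast\in\{\text{blank},+,-,b\}$ let $\boldsymbol K^{\ast}(R)$ be the homotopy category of all (respectively bounded below, bounded above, bounded) complexes of modules, let $\boldsymbol K^{\ast}_n(R)$ be its triangulated subcategory of $n$-exact complexes, and let $\boldsymbol D^{\ast}_n(R)=\boldsymbol K^{\ast}(R)/\boldsymbol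 K^{\ast}_n(R)$ be the Verdier quotient. For $n\le m$ let $\boldsymbol K^{\ast}_{n,m}(R)=\boldsymbol K^{\ast}_n(R)/\boldsymbol K^{\ast}_m(R)$ be the Verdier quotient, regarded as a triangulated subcategory of $\boldsymbol D^{\ast}_m(R)$ through the fully faithful functor induced by the inclusion $\boldsymbol K^{\ast}_n(R)\subseteq\boldsymbol K^{\ast}(R)$. **Theorem.** Let $R$ be a ring and $\ast\in\{\text{blank},+,-,b\}$. For all $n,m\in\{0,1,2,\dots\}\cup\{\infty\}$ with $n\le m$ there is a triangulated equivalence $$\boldsymbol D^{\ast}_n(R)\cong \boldsymbol D^{\ast}_m(R)/\boldsymbol K^{\ast}_{n,m}(R),$$ compatible (as triangulated functors, up to isomorphism) with the canonical functors from $\boldsymbol K^{\ast}(R)$. Moreover, for each $n\in\mathbb N$ the following statements are equivalent, where $m$ ranges over $\{0,1,2,\dots\}\cup\{\infty\}$: 1. $\mathrm{l.fPD}(R)\le n$; 2. $\boldsymbol K^{\ast}_{n,m}(R)=0$ for all $m>n$; 3. $\boldsymbol K^{\ast}_{n,m}(R)=0$ for some $m>n$; 4. $\boldsymbol D^{\ast}_m(R)$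 is naturally triangle equivalent to $\boldsymbol D^{\ast}_n(R)$ for all $m>n$; 5. $\boldsymbol D^{\ast}_m(R)$ is naturally triangle equivalent to $\boldsymbol D^{\ast}_n(R)$ for some $m>n$. Here "naturally" means through a triangulated functor $\boldsymbol D^{\ast}_m(R)\to \boldsymbol D^{\ast}_n(R)$ induced by the identity of $\boldsymbol K^{\ast}(R)$, that is, one whose composite with the projection $\boldsymbol K^{\ast}(R)\to\boldsymbol D^{\ast}_m(R)$ is isomorphic, as a triangulated functor, to the projection $\boldsymbol K^{\ast}(R)\to\boldsymbol D^{\ast}_n(R)$. -/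

import Mathlib

open CategoryTheory Limits Pretriangulated ZeroObject

universe u

namespace RelDer

variable (R : Type u) [Ring R]

/-! ### Modules with finite projective resolutions -/

section Modules

variable {R}

/-- `M` has a finite projective resolution `0 → P_k → ⋯ → P₁ → P₀ → M → 0` of length at most `k`
with all `P_i` finitely generated projective (the sequence is extended by zero beyond `k`). -/
def HasFinProjRes (k : ℕ) (M : ModuleCat.{u} R) : Prop :=
  ∃ (P : ℕ → ModuleCat.{u} R) (d : ∀ i, P (i + 1) ⟶ P i) (ε : P 0 ⟶ M),
    (∀ i, Module.Finite R (P i) ∧ Module.Projective R (P i)) ∧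
    (∀ i, k < i → Subsingleton (P i)) ∧
    Function.Surjective ε.hom ∧
    Function.Exact (d 0).hom ε.hom ∧
    ∀ i, Function.Exact (d (i + 1)).hom (d i).hom

/-- The class `𝒫^{<n+1}`: modules having a finite resolution by finitely generated projectives
of length less than `n + 1` (where `∞ + 1 = ∞`). -/
def InP (n : ℕ∞) (M : ModuleCat.{u} R) : Prop :=
  ∃ k : ℕ, (k : ℕ∞) < n + 1 ∧ HasFinProjRes k M

end Modules

/-- The left little finitistic dimension: the supremum of the projective dimensions of all left
modules having a finite resolution by finitely generated projectives. -/
noncomputable def lfPD : WithBot ℕ∞ :=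
  ⨆ M : {M : ModuleCat.{u} R // ∃ k : ℕ, HasFinProjRes k M}, projectiveDimension M.1

/-! ### Exactness relative to `𝒫^{<n+1}` -/

section NExact

variable {R}

/-- A sequence `0 → A → B → C → 0` is `n`-exact if it is short exact and
`0 → Hom(M, A) → Hom(M, B) → Hom(M, C) → 0` is short exact for all `M ∈ 𝒫^{<n+1}`. -/
def IsNExactSeq (n : ℕ∞) (S : ShortComplex (ModuleCat.{u} R)) : Prop :=
  S.ShortExact ∧ ∀ M : ModuleCat.{u} R, InP n M →
    (S.map (preadditiveCoyoneda.obj (Opposite.op M))).ShortExact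

/-- A complex `X` is `n`-exact at `i` if `0 → Ker d^i → X^i → Coker d^{i-1} → 0` is an `n`-exact
sequence (in particular, the composition of the two maps vanishes). -/
def IsNExactAt (n : ℕ∞) (X : CochainComplex (ModuleCat.{u} R) ℤ) (i : ℤ) : Prop :=
  ∃ w : kernel.ι (X.d i (i + 1)) ≫ cokernel.π (X.d (i - 1) i) = 0,
    IsNExactSeq n (ShortComplex.mk _ _ w)

/-- A complex is `n`-exact if it is so in every degree. -/
def IsNExact (n : ℕ∞) (X : CochainComplex (ModuleCat.{u} R) ℤ) : Prop :=
  ∀ i : ℤ, IsNExactAt n X i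

/-! #### `n`-exactness in terms of `Hom`-complexes -/

lemma InP.mono {n m : ℕ∞} (h : n ≤ m) {M : ModuleCat.{u} R} (hM : InP n M) : InP m M := by
  obtain ⟨k, hk, hM⟩ := hM
  exact ⟨k, hk.trans_le (by gcongr), hM⟩

lemma IsNExact.anti {n m : ℕ∞} (h : n ≤ m) {X : CochainComplex (ModuleCat.{u} R) ℤ}
    (hX : IsNExact m X) : IsNExact n X := fun i => by
  obtain ⟨w, h₁, h₂⟩ := hX i
  exact ⟨w, h₁, fun M hM => h₂ M (hM.mono h)⟩

lemma inP_self (n : ℕ∞) : InP n (ModuleCat.of R R) := by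
  let P : ℕ → ModuleCat.{u} R := fun i => match i with
    | 0 => ModuleCat.of R R
    | _ + 1 => ModuleCat.of R PUnit
  have hP (i : ℕ) : Subsingleton (P (i + 1)) := inferInstanceAs (Subsingleton PUnit)
  refine ⟨0, by simp, P, fun i => 0, 𝟙 _, fun i => ?_, fun i hi => ?_, fun x => ⟨x, rfl⟩,
    fun x => ⟨fun hx => ⟨0, ?_⟩, ?_⟩, fun i x => ⟨fun _ => ⟨0, Subsingleton.elim _ _⟩,
      fun _ => rfl⟩⟩
  · match i with
    | 0 => exact ⟨inferInstanceAs (Module.Finite R R), inferInstanceAs (Module.Projective R R)⟩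
    | _ + 1 => exact ⟨inferInstanceAs (Module.Finite R PUnit.{u + 1}),
        inferInstanceAs (Module.Projective R PUnit.{u + 1})⟩
  · match i with
    | 0 => exact absurd hi (lt_irrefl 0)
    | i + 1 => exact hP i
  · simpa using hx.symm
  · rintro ⟨y, rfl⟩
    rfl

/-- The complex `Hom(M, X)`. -/
noncomputable abbrev homCx (M : ModuleCat.{u} R) (X : CochainComplex (ModuleCat.{u} R) ℤ) :
    CochainComplex AddCommGrpCat.{u} ℤ :=
  ((preadditiveCoyoneda.obj (Opposite.op M)).mapHomologicalComplex (ComplexShape.up ℤ)).obj X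

lemma homCx_exactAt_iff (M : ModuleCat.{u} R) (X : CochainComplex (ModuleCat.{u} R) ℤ)
    (i j k : ℤ) (hi : i + 1 = j) (hk : j + 1 = k) :
    (homCx M X).ExactAt j ↔
      ∀ f : M ⟶ X.X j, f ≫ X.d j k = 0 → ∃ g : M ⟶ X.X i, g ≫ X.d i j = f := by
  rw [HomologicalComplex.exactAt_iff' _ i j k (by simp [← hi]) (by simp [hk]),
    ShortComplex.ab_exact_iff]
  rfl

lemma exact_of_isNExactAt {n : ℕ∞} {X : CochainComplex (ModuleCat.{u} R) ℤ} {i : ℤ}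
    (h : IsNExactAt n X i) (x : X.X i) (hx : X.d i (i + 1) x = 0) :
    ∃ y, X.d (i - 1) i y = x := by
  obtain ⟨w, -⟩ := h
  let S := ShortComplex.mk (X.d (i - 1) i) (X.d i (i + 1)) (X.d_comp_d _ _ _)
  have hS : S.Exact := S.exact_iff_kernel_ι_comp_cokernel_π_zero.2 w
  exact (S.moduleCat_exact_iff).1 hS x hx

lemma mono_desc {X : CochainComplex (ModuleCat.{u} R) ℤ} {i : ℤ}
    (w : kernel.ι (X.d i (i + 1)) ≫ cokernel.π (X.d (i - 1) i) = 0) :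
    Mono (cokernel.desc (X.d (i - 1) i) (X.d i (i + 1)) (X.d_comp_d _ _ _)) := by
  rw [ModuleCat.mono_iff_injective, injective_iff_map_eq_zero]
  intro c hc
  obtain ⟨x, rfl⟩ := (ModuleCat.epi_iff_surjective (cokernel.π (X.d (i - 1) i))).1 inferInstance c
  have hx : X.d i (i + 1) x = 0 := by
    rw [← hc, ← ConcreteCategory.comp_apply, cokernel.π_desc]
  obtain ⟨y, rfl⟩ := (ShortComplex.moduleCat_exact_iff _).1
    (ShortComplex.exact_kernel (X.d i (i + 1))) x hx
  rw [← ConcreteCategory.comp_apply]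
  exact congr($w y)

lemma isNExact_iff (n : ℕ∞) (X : CochainComplex (ModuleCat.{u} R) ℤ) :
    IsNExact n X ↔ ∀ M, InP n M → ∀ i, (homCx M X).ExactAt i := by
  constructor
  · intro h M hM j
    obtain ⟨i, rfl⟩ : ∃ i, j = i + 1 := ⟨j - 1, by simp⟩
    rw [homCx_exactAt_iff M X i (i + 1) (i + 1 + 1) rfl rfl]
    intro f hf
    obtain ⟨w, hw, hM'⟩ := h i
    have := mono_desc w
    let T := ShortComplex.mk (cokernel.desc (X.d (i - 1) i) (X.d i (i + 1)) (X.d_comp_d _ _ _))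
      (X.d (i + 1) (i + 1 + 1)) (by simp [← cancel_epi (cokernel.π (X.d (i - 1) i))])
    have hT : T.Exact := by
      rw [ShortComplex.moduleCat_exact_iff]
      intro x hx
      obtain ⟨y, rfl⟩ : ∃ y' : X.X i, X.d i (i + 1) y' = x := by
        have h' := exact_of_isNExactAt (h (i + 1)) x hx
        rwa [show i + 1 - 1 = i by simp] at h'
      refine ⟨cokernel.π (X.d (i - 1) i) y, ?_⟩
      dsimp [T]
      rw [← ConcreteCategory.comp_apply, cokernel.π_desc]
    have hmono : Mono T.f := this
    obtain ⟨g, hg⟩ : ∃ g : M ⟶ T.X₁, g ≫ T.f = f := ⟨hT.lift f hf, hT.lift_f f hf⟩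
    have hepi := (hM' M hM).epi_g
    obtain ⟨g', hg'⟩ := (AddCommGrpCat.epi_iff_surjective _).1 hepi g
    obtain ⟨g', hg'⟩ : ∃ g' : M ⟶ X.X i, g' ≫ cokernel.π (X.d (i - 1) i) = g := ⟨g', hg'⟩
    refine ⟨g', ?_⟩
    rw [← hg, ← hg', Category.assoc]
    simp only [T, cokernel.π_desc]
  · intro h i
    have hX : ∀ i (x : X.X i), X.d i (i + 1) x = 0 → ∃ y, X.d (i - 1) i y = x := by
      intro i x hx
      obtain ⟨g, hg⟩ := (homCx_exactAt_iff (ModuleCat.of R R) X (i - 1) i (i + 1) (by simp)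
        rfl).1 (h _ (inP_self n) i) (ModuleCat.ofHom (LinearMap.toSpanSingleton R _ x)) (by
          ext
          simpa using hx)
      refine ⟨g (1 : R), ?_⟩
      rw [← ConcreteCategory.comp_apply, hg]
      simp
    have w : kernel.ι (X.d i (i + 1)) ≫ cokernel.π (X.d (i - 1) i) = 0 := by
      let S := ShortComplex.mk (X.d (i - 1) i) (X.d i (i + 1)) (X.d_comp_d _ _ _)
      exact S.exact_iff_kernel_ι_comp_cokernel_π_zero.1 (S.moduleCat_exact_iff.2 (hX i))
    have hmono := mono_desc w
    have hS : (ShortComplex.mk _ _ w).ShortExact := by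
      refine ShortComplex.ShortExact.mk' ?_ inferInstance inferInstance
      rw [ShortComplex.moduleCat_exact_iff]
      intro x hx
      refine (ShortComplex.moduleCat_exact_iff _).1
        (ShortComplex.exact_kernel (X.d i (i + 1))) x ?_
      have : X.d i (i + 1) x = cokernel.desc (X.d (i - 1) i) (X.d i (i + 1)) (X.d_comp_d _ _ _)
          (cokernel.π (X.d (i - 1) i) x) := by
        rw [← ConcreteCategory.comp_apply, cokernel.π_desc]
      dsimp at hx ⊢
      rw [this, hx, map_zero]
    refine ⟨w, hS, fun M hM => ?_⟩
    have := hS.mono_f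
    refine ShortComplex.ShortExact.mk' ?_ ?_ ?_
    · rw [ShortComplex.ab_exact_iff]
      intro f hf
      exact ⟨hS.exact.lift f hf, hS.exact.lift_f f hf⟩
    · rw [AddCommGrpCat.mono_iff_injective]
      intro f g hfg
      exact (cancel_mono (kernel.ι (X.d i (i + 1)))).1 hfg
    · rw [AddCommGrpCat.epi_iff_surjective]
      intro (f : M ⟶ cokernel (X.d (i - 1) i))
      obtain ⟨g, hg⟩ := (homCx_exactAt_iff M X i (i + 1) (i + 1 + 1) rfl rfl).1 (h M hM _)
        (f ≫ cokernel.desc (X.d (i - 1) i) (X.d i (i + 1)) (X.d_comp_d _ _ _)) (by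
          rw [Category.assoc]
          convert comp_zero
          simp [← cancel_epi (cokernel.π (X.d (i - 1) i))])
      refine ⟨g, ?_⟩
      change g ≫ cokernel.π (X.d (i - 1) i) = f
      rw [← cancel_mono (cokernel.desc (X.d (i - 1) i) (X.d i (i + 1)) (X.d_comp_d _ _ _)), ← hg]
      simp

end NExact

/-! ### Homotopy categories -/

/-- The homotopy category `K(R)` of complexes of left `R`-modules. -/
abbrev HK := HomotopyCategory (ModuleCat.{u} R) (ComplexShape.up ℤ)

/-- The possible values `blank, +, -, b` of the boundedness decoration. -/
inductive Bdd
  | blank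
  | plus
  | minus
  | b

variable {R} in
/-- The complexes allowed by a boundedness decoration: all of them, the bounded below ones
(`X^i = 0` for `i ≪ 0`), the bounded above ones (`X^i = 0` for `i ≫ 0`), the bounded ones. -/
def Bdd.Holds (X : CochainComplex (ModuleCat.{u} R) ℤ) : Bdd → Prop
  | blank => True
  | plus => ∃ a, X.IsStrictlyGE a
  | minus => ∃ c, X.IsStrictlyLE c
  | b => (∃ a, X.IsStrictlyGE a) ∧ ∃ c, X.IsStrictlyLE c

/-- The complexes allowed by a boundedness decoration, as objects of `K(R)`. -/
def bddProp (s : Bdd) : ObjectProperty (HK R) := fun X => s.Holds X.as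

lemma holds_zero (s : Bdd) (X : CochainComplex (ModuleCat.{u} R) ℤ) (hX : IsZero X) :
    s.Holds X := by
  have h (i : ℤ) : IsZero (X.X i) :=
    (HomologicalComplex.eval (ModuleCat.{u} R) (ComplexShape.up ℤ) i).map_isZero hX
  have h₁ : X.IsStrictlyGE 0 := (CochainComplex.isStrictlyGE_iff _ _).2 fun i _ => h i
  have h₂ : X.IsStrictlyLE 0 := (CochainComplex.isStrictlyLE_iff _ _).2 fun i _ => h i
  cases s
  exacts [trivial, ⟨0, h₁⟩, ⟨0, h₂⟩, ⟨⟨0, h₁⟩, 0, h₂⟩]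

lemma holds_shift (s : Bdd) (X : CochainComplex (ModuleCat.{u} R) ℤ) (n : ℤ) (hX : s.Holds X) :
    s.Holds (X⟦n⟧) := by
  have h₁ : (∃ a, X.IsStrictlyGE a) → ∃ a, (X⟦n⟧).IsStrictlyGE a := fun ⟨a, _⟩ =>
    ⟨a - n, X.isStrictlyGE_shift a n _ (by lia)⟩
  have h₂ : (∃ a, X.IsStrictlyLE a) → ∃ a, (X⟦n⟧).IsStrictlyLE a := fun ⟨a, _⟩ =>
    ⟨a - n, X.isStrictlyLE_shift a n _ (by lia)⟩
  cases s
  exacts [trivial, h₁ hX, h₂ hX, ⟨h₁ hX.1, h₂ hX.2⟩]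

lemma holds_cone (s : Bdd) {X Y : CochainComplex (ModuleCat.{u} R) ℤ} (f : X ⟶ Y)
    (hX : s.Holds X) (hY : s.Holds Y) : s.Holds (CochainComplex.mappingCone f) := by
  have h₁ : (∃ a, X.IsStrictlyGE a) → (∃ a, Y.IsStrictlyGE a) →
      ∃ a, (CochainComplex.mappingCone f).IsStrictlyGE a := fun ⟨a, _⟩ ⟨c, _⟩ =>
    ⟨min (a - 1) c, CochainComplex.isStrictlyGE_mappingCone f a c _ (by simp) (by simp)⟩
  have h₂ : (∃ a, X.IsStrictlyLE a) → (∃ a, Y.IsStrictlyLE a) →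
      ∃ a, (CochainComplex.mappingCone f).IsStrictlyLE a := fun ⟨a, _⟩ ⟨c, _⟩ =>
    ⟨max a c, (CochainComplex.isStrictlyLE_iff _ _).2 fun i hi => by
      simp only [CochainComplex.mappingCone.isZero_X_iff]
      have := le_max_left a c
      have := le_max_right a c
      exact ⟨X.isZero_of_isStrictlyLE a _ (by lia), Y.isZero_of_isStrictlyLE c _ (by lia)⟩⟩
  cases s
  exacts [trivial, h₁ hX hY, h₂ hX hY, ⟨h₁ hX.1 hY.1, h₂ hX.2 hY.2⟩]

instance (s : Bdd) : (bddProp R s).ContainsZero where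
  exists_zero := ⟨(HomotopyCategory.quotient _ _).obj (0 : CochainComplex (ModuleCat.{u} R) ℤ), Functor.map_isZero _ (isZero_zero _),
    holds_zero R s _ (isZero_zero _)⟩

instance (s : Bdd) : (bddProp R s).IsStableUnderShift ℤ where
  isStableUnderShiftBy n := ⟨fun X hX => by
    obtain ⟨X : CochainComplex _ _, rfl⟩ := X.quotient_obj_surjective
    rw [ObjectProperty.prop_shift_iff, HomotopyCategory.shift_quotient_obj]
    exact holds_shift R s X n hX⟩

instance (s : Bdd) : (bddProp R s).IsTriangulatedClosed₃ where
  ext₃' T hT h₁ h₂ := by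
    obtain ⟨f : T.obj₁.as ⟶ T.obj₂.as, hf⟩ :=
      (HomotopyCategory.quotient _ _).map_surjective T.mor₁
    refine ⟨_, ?_, ⟨Triangle.π₃.mapIso (isoTriangleOfIso₁₂ T _ hT
      (HomotopyCategory.mappingCone_triangleh_distinguished f)
        (Iso.refl _) (Iso.refl _) ?_)⟩⟩
    · exact holds_cone R s f h₁ h₂
    · exact (Category.comp_id _).trans (hf.symm.trans (Category.id_comp _).symm)

instance (s : Bdd) : (bddProp R s).IsTriangulated where
  toIsTriangulatedClosed₂ := .of_isTriangulatedClosed₃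

/-- The homotopy category `K^*(R)`, a triangulated category. -/
abbrev KB (s : Bdd) := (bddProp R s).FullSubcategory

/-! ### The subcategories of `n`-exact complexes -/

/-- The `n`-exact complexes, as objects of `K(R)`. -/
def nExactK (n : ℕ∞) : ObjectProperty (HK R) := fun X => IsNExact n X.as

/-- The functor `Hom(M, -)` on homotopy categories. -/
noncomputable abbrev homK (M : ModuleCat.{u} R) :
    HK R ⥤ HomotopyCategory AddCommGrpCat.{u} (ComplexShape.up ℤ) :=
  (preadditiveCoyoneda.obj (Opposite.op M)).mapHomotopyCategory (ComplexShape.up ℤ)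

lemma nExactK_iff (n : ℕ∞) (X : HK R) :
    nExactK R n X ↔ ∀ M, InP n M →
      ((HomotopyCategory.subcategoryAcyclic AddCommGrpCat.{u}).inverseImage (homK R M)) X := by
  refine (isNExact_iff n X.as).trans (forall_congr' fun M => forall_congr' fun _ => ?_)
  exact (HomotopyCategory.quotient_obj_mem_subcategoryAcyclic_iff_exactAt (homCx M X.as)).symm

instance (n : ℕ∞) : (nExactK R n).IsClosedUnderIsomorphisms where
  of_iso e hX := (nExactK_iff R n _).2 fun M hM =>
    ObjectProperty.prop_of_iso _ e ((nExactK_iff R n _).1 hX M hM)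

instance (n : ℕ∞) : (nExactK R n).IsTriangulated where
  exists_zero := ⟨(0 : HK R), isZero_zero _, (nExactK_iff R n _).2 fun _ _ =>
    ObjectProperty.prop_of_isZero _ (isZero_zero _)⟩
  isStableUnderShiftBy a := ⟨fun _ hX => (nExactK_iff R n _).2 fun M hM =>
    ObjectProperty.le_shift _ a _ ((nExactK_iff R n _).1 hX M hM)⟩
  toIsTriangulatedClosed₂ := .mk' fun T hT h₁ h₃ => (nExactK_iff R n _).2 fun M hM =>
    ObjectProperty.ext_of_isTriangulatedClosed₂ _ T hT
      ((nExactK_iff R n _).1 h₁ M hM) ((nExactK_iff R n _).1 h₃ M hM)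

/-- The triangulated subcategory `K^*_n(R)` of `K^*(R)` consisting of the `n`-exact complexes. -/
abbrev nExactB (s : Bdd) (n : ℕ∞) : ObjectProperty (KB R s) :=
  (nExactK R n).inverseImage (bddProp R s).ι

/-! ### Verdier quotients -/

section Verdier

variable {C : Type*} [Category* C] [HasZeroObject C] [HasShift C ℤ] [Preadditive C]
  [∀ k : ℤ, (shiftFunctor C k).Additive] [Pretriangulated C] (P : ObjectProperty C)

/-- The Verdier quotient of a triangulated category by a triangulated subcategory `P`: the
localization at the morphisms having a cone in `P`, with the triangulated structure for which
the distinguished triangles are, up to isomorphism, the images of distinguished triangles. -/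
def VQuot := P.trW.Localization

noncomputable instance : Category (VQuot P) := inferInstanceAs (Category P.trW.Localization)

/-- The projection to the Verdier quotient. -/
def VQuot.Q : C ⥤ VQuot P := P.trW.Q

instance : (VQuot.Q P).IsLocalization P.trW := inferInstanceAs (P.trW.Q.IsLocalization P.trW)

variable [IsTriangulated C] [P.IsTriangulated]

noncomputable instance : HasShift (VQuot P) ℤ := inferInstanceAs (HasShift P.trW.Localization ℤ)

noncomputable instance : Preadditive (VQuot P) := inferInstanceAs (Preadditive P.trW.Localization)

instance : HasZeroObject (VQuot P) := inferInstanceAs (HasZeroObject P.trW.Localization)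

instance (k : ℤ) : (shiftFunctor (VQuot P) k).Additive :=
  inferInstanceAs (shiftFunctor P.trW.Localization k).Additive

noncomputable instance : Pretriangulated (VQuot P) :=
  inferInstanceAs (Pretriangulated P.trW.Localization)

instance : IsTriangulated (VQuot P) := inferInstanceAs (IsTriangulated P.trW.Localization)

noncomputable instance : (VQuot.Q P).CommShift ℤ := inferInstanceAs (P.trW.Q.CommShift ℤ)

instance : (VQuot.Q P).IsTriangulated :=
  Triangulated.Localization.isTriangulated_functor P.trW.Q P.trW

end Verdier

/-- The `n`-derived category `D^*_n(R) = K^*(R) / K^*_n(R)`. -/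
abbrev DB (s : Bdd) (n : ℕ∞) := VQuot (nExactB R s n)

/-- The Verdier quotient `K^*_{n,m}(R) = K^*_n(R) / K^*_m(R)` (used for `n ≤ m`). -/
abbrev KQ (s : Bdd) (n m : ℕ∞) :=
  VQuot ((nExactB R s m).inverseImage (nExactB R s n).ι)

lemma nExactB_anti (s : Bdd) {n m : ℕ∞} (h : n ≤ m) : nExactB R s m ≤ nExactB R s n :=
  fun _ hX => IsNExact.anti h hX

lemma isVerdierRightLocalizing (s : Bdd) {n m : ℕ∞} (h : n ≤ m) :
    (nExactB R s n).IsVerdierRightLocalizing (nExactB R s m) where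
  fac {X _} f hX _ := ⟨X, 𝟙 X, f, nExactB_anti R s h _ hX, hX, Category.id_comp f⟩

/-- The functor `K^*_{n,m}(R) ⥤ D^*_m(R)` induced by the inclusion `K^*_n(R) ⥤ K^*(R)`. -/
noncomputable abbrev KQtoD (s : Bdd) (n m : ℕ∞) : KQ R s n m ⥤ DB R s m :=
  ((nExactB R s n).triangulatedLocalizerMorphism (nExactB R s m)).localizedFunctor
    (VQuot.Q ((nExactB R s m).inverseImage (nExactB R s n).ι)) (VQuot.Q (nExactB R s m))

lemma KQtoD_full (s : Bdd) {n m : ℕ∞} (h : n ≤ m) : (KQtoD R s n m).Full := by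
  have := isVerdierRightLocalizing R s h
  infer_instance

lemma KQtoD_faithful (s : Bdd) {n m : ℕ∞} (h : n ≤ m) : (KQtoD R s n m).Faithful := by
  have := isVerdierRightLocalizing R s h
  infer_instance

instance (s : Bdd) (n m : ℕ∞) : (KQtoD R s n m).IsTriangulated := by
  let A := nExactB R s n
  let B := nExactB R s m
  let e := CatCommSq.iso (A.triangulatedLocalizerMorphism B).functor
    (VQuot.Q (B.inverseImage A.ι)) (VQuot.Q B) (KQtoD R s n m)
  have h : NatTrans.CommShift e.hom ℤ :=
    LocalizerMorphism.natTransCommShift_hom (A.triangulatedLocalizerMorphism B) _ _ _ e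
  have : NatTrans.CommShift e.symm.hom ℤ := inferInstanceAs (NatTrans.CommShift e.inv ℤ)
  have := Localization.essSurj_mapArrow (VQuot.Q (B.inverseImage A.ι)) (B.inverseImage A.ι).trW
  exact Functor.isTriangulated_of_precomp_iso e.symm

/-- For `n ≤ m`, the category `K^*_{n,m}(R)` as a (replete) triangulated subcategory of
`D^*_m(R)`, via the fully faithful functor `KQtoD`. -/
def KSub (s : Bdd) {n m : ℕ∞} (_ : n ≤ m) : ObjectProperty (DB R s m) :=
  (KQtoD R s n m).essImage

instance (s : Bdd) {n m : ℕ∞} (h : n ≤ m) : (KSub R s h).IsTriangulated := by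
  have := KQtoD_full R s h
  exact ObjectProperty.instIsTriangulatedEssImageOfIsTriangulatedOfFull (KQtoD R s n m)

/-- The Verdier quotient `D^*_m(R) / K^*_{n,m}(R)`, for `n ≤ m`. -/
abbrev DQ (s : Bdd) {n m : ℕ∞} (h : n ≤ m) := VQuot (KSub R s h)

/-- `D₁` and `D₂` are triangle equivalent under `C`: there is an equivalence `F : D₁ ⥤ D₂` which is
a triangulated functor, together with an isomorphism `L₁ ⋙ F ≅ L₂` of triangulated functors. -/
def TriangleEquivUnder {C D₁ D₂ : Type*} [Category* C] [Category* D₁] [Category* D₂]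
    [HasShift C ℤ]
    [HasZeroObject D₁] [HasShift D₁ ℤ] [Preadditive D₁]
    [∀ k : ℤ, (shiftFunctor D₁ k).Additive] [Pretriangulated D₁]
    [HasZeroObject D₂] [HasShift D₂ ℤ] [Preadditive D₂]
    [∀ k : ℤ, (shiftFunctor D₂ k).Additive] [Pretriangulated D₂]
    (L₁ : C ⥤ D₁) (L₂ : C ⥤ D₂) [L₁.CommShift ℤ] [L₂.CommShift ℤ] : Prop :=
  ∃ (F : D₁ ⥤ D₂) (_ : F.CommShift ℤ) (e : L₁ ⋙ F ≅ L₂),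
    F.IsTriangulated ∧ F.IsEquivalence ∧ NatTrans.CommShift e.hom ℤ

/-- `D^*_n(R)` and `D^*_m(R) / K^*_{n,m}(R)` are triangle equivalent, compatibly with the
projections from `K^*(R)`. -/
def DEquivQuot (s : Bdd) {n m : ℕ∞} (h : n ≤ m) : Prop :=
  TriangleEquivUnder (VQuot.Q (nExactB R s n))
    (VQuot.Q (nExactB R s m) ⋙ VQuot.Q (KSub R s h))

/-- `D^*_m(R)` is naturally triangle equivalent to `D^*_n(R)`, i.e. through a functor induced by
the identity of `K^*(R)`. -/
def DNatEquiv (s : Bdd) (m n : ℕ∞) : Prop :=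
  TriangleEquivUnder (VQuot.Q (nExactB R s m)) (VQuot.Q (nExactB R s n))

/-- `K^*_{n,m}(R) = 0`. -/
def KQZero (s : Bdd) (n m : ℕ∞) : Prop :=
  ∀ X : KQ R s n m, IsZero X

end RelDer

/-! By `isNExact_iff`, a complex is `n`-exact when `Hom(M, -)` makes it acyclic for every `M` in
`𝒫^{<n+1}`. Hence `K_n` is the whole kernel of `K → D_n` (`nExactB_of_isZero_Q_obj`). This gives the
iterated quotient `D_m / K_{n,m} ≅ D_n`, and reduces both `K_{n,m} = 0` and the natural equivalence
`D_m ≅ D_n` to the equality `K_n = K_m`.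

If `lfPD ≤ n`, the test classes for `n` and `m` coincide, so `K_n = K_m`. Conversely, let `K_n =
K_m` with `m > n`, and let `M` have a resolution of length `n + 1`. Map the direct sum of all
representatives of `𝒫^{<n+1}`, one copy for each morphism to `M`, onto `M`. With its kernel this is
an `n`-exact three-term complex, hence `m`-exact, so `𝟙 M` lifts. As `M` is finitely generated, it
is a retract of a finite sum of modules of projective dimension at most `n`. Its resolution can thus
be shortened to length `n`, and induction on the length bounds `lfPD`. -/

namespace RelDer

/-! ### Iterated Verdier quotients. -/

section Verdier

/-- Uniqueness of localizations gives the equivalence, with its shift structure induced from `L₂`.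
It is triangulated because, by the calculus of fractions, every arrow of `D₁` comes from `C` up to
isomorphism. -/
lemma triangleEquivUnder_of_isLocalization {C D₁ D₂ : Type*}
    [Category* C] [Category* D₁] [Category* D₂]
    [HasZeroObject C] [HasShift C ℤ] [Preadditive C]
    [∀ k : ℤ, (shiftFunctor C k).Additive] [Pretriangulated C]
    [HasZeroObject D₁] [HasShift D₁ ℤ] [Preadditive D₁]
    [∀ k : ℤ, (shiftFunctor D₁ k).Additive] [Pretriangulated D₁]
    [HasZeroObject D₂] [HasShift D₂ ℤ] [Preadditive D₂]
    [∀ k : ℤ, (shiftFunctor D₂ k).Additive] [Pretriangulated D₂]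
    (W : MorphismProperty C) (L₁ : C ⥤ D₁) (L₂ : C ⥤ D₂) [L₁.CommShift ℤ] [L₂.CommShift ℤ]
    [L₁.IsTriangulated] [L₂.IsTriangulated] [L₁.IsLocalization W] [L₂.IsLocalization W]
    [W.HasLeftCalculusOfFractions] :
    TriangleEquivUnder L₁ L₂ := by
  let F := (Localization.uniq L₁ L₂ W).functor
  let _ : Localization.Lifting L₁ W L₂ F := ⟨Localization.compUniqFunctor L₁ L₂ W⟩
  let _ : F.CommShift ℤ := Functor.commShiftOfLocalization L₁ W ℤ L₂ F
  let e : L₁ ⋙ F ≅ L₂ := Localization.Lifting.iso L₁ W L₂ F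
  have he : NatTrans.CommShift e.hom ℤ := NatTrans.commShift_iso_hom_of_localization ..
  have := Localization.essSurj_mapArrow L₁ W
  exact ⟨F, inferInstance, e, Functor.isTriangulated_of_precomp_iso e, inferInstance, he⟩

variable {C : Type*} [Category* C] [HasZeroObject C] [HasShift C ℤ] [Preadditive C]
  [∀ k : ℤ, (shiftFunctor C k).Additive] [Pretriangulated C] [IsTriangulated C]

/-- The Verdier quotient kills the objects of the subcategory. -/
lemma isZero_Q_obj (P : ObjectProperty C) [P.IsTriangulated] {X : C} (hX : P X) :
    IsZero ((VQuot.Q P).obj X) := by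
  have h : P.trW (0 : X ⟶ 0) :=
    (P.trW_iff' _).2 ⟨X, 𝟙 X, 0, contractible_distinguished X, hX⟩
  have := Localization.inverts (VQuot.Q P) P.trW _ h
  exact ((VQuot.Q P).map_isZero (isZero_zero C)).of_iso (asIso ((VQuot.Q P).map (0 : X ⟶ 0)))

/-- `𝟙 X` and `0` agree in the quotient, so some denominator `s` equalizes them; then `s` itself is
zero. -/
lemma exists_trW_zero_of_isZero_Q_obj (P : ObjectProperty C) [P.IsTriangulated] {X : C}
    (hX : IsZero ((VQuot.Q P).obj X)) : ∃ Y, P.trW (0 : X ⟶ Y) := by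
  obtain ⟨Y, s, hs, h⟩ := (MorphismProperty.map_eq_iff_postcomp (VQuot.Q P) P.trW
    (𝟙 X) 0).1 (hX.eq_of_src _ _)
  obtain rfl : s = 0 := by simpa using h
  exact ⟨Y, hs⟩

/-- Objects of a thick subcategory are detected by the Verdier quotient by a smaller one. -/
lemma prop_of_iso_Q_obj {A B : ObjectProperty C} [A.IsTriangulated] [B.IsTriangulated]
    (hBA : B ≤ A) (hA : ∀ X, IsZero ((VQuot.Q A).obj X) → A X) {X Y : C}
    (e : (VQuot.Q B).obj X ≅ (VQuot.Q B).obj Y) (hX : A X) : A Y := by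
  have hinv : B.trW.IsInvertedBy (VQuot.Q A) := fun _ _ f hf =>
    Localization.inverts (VQuot.Q A) A.trW f (ObjectProperty.trW_monotone hBA _ hf)
  let F := Localization.lift (VQuot.Q A) hinv (VQuot.Q B)
  let i : VQuot.Q B ⋙ F ≅ VQuot.Q A := Localization.fac _ hinv _
  exact hA _ ((isZero_Q_obj A hX).of_iso
    ((i.app Y).symm ≪≫ F.mapIso e.symm ≪≫ i.app X))

/-- A quotient of a Verdier quotient is a Verdier quotient. -/
lemma isLocalization_comp_Q {A B : ObjectProperty C} [A.IsTriangulated] [B.IsTriangulated]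
    (hBA : B ≤ A) (hA : ∀ X, IsZero ((VQuot.Q A).obj X) → A X)
    (S : ObjectProperty (VQuot B)) [S.IsTriangulated]
    (hS : ∀ Z, S Z ↔ ∃ X, A X ∧ Nonempty ((VQuot.Q B).obj X ≅ Z)) :
    (VQuot.Q B ⋙ VQuot.Q S).IsLocalization A.trW := by
  have := Localization.essSurj_mapArrow (VQuot.Q B) B.trW
  refine Functor.IsLocalization.comp _ _ B.trW S.trW A.trW ?_ (ObjectProperty.trW_monotone hBA) ?_
  · rintro X Y f ⟨Z, g, h, hT, hZ⟩
    exact Localization.inverts (VQuot.Q S) S.trW _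
      (ObjectProperty.trW.mk S ((VQuot.Q B).map_distinguished _ hT)
        ((hS _).2 ⟨Z, hZ, ⟨Iso.refl _⟩⟩))
  · intro X Y f hf
    -- Lift `f` to an arrow `φ` of `C`. The image of its cone lies in `S` up to isomorphism, so the
    -- cone lies in `A`.
    obtain ⟨φ, ⟨e⟩⟩ : ∃ φ : Arrow C, Nonempty ((VQuot.Q B).mapArrow.obj φ ≅ Arrow.mk f) :=
      ⟨_, ⟨Functor.objObjPreimageIso _ _⟩⟩
    refine ((A.trW.map (VQuot.Q B)).arrow_mk_iso_iff e).1 (A.trW.map_mem_map _ _ ?_)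
    obtain ⟨Z, g, h, hT⟩ := distinguished_cocone_triangle φ.hom
    have hf' : S.trW ((VQuot.Q B).map φ.hom) := (S.trW.arrow_mk_iso_iff e).2 hf
    have hc := (ObjectProperty.trW_iff_of_distinguished S.isoClosure _
      ((VQuot.Q B).map_distinguished _ hT)).1 (by rwa [ObjectProperty.trW_isoClosure])
    obtain ⟨Z', hZ', ⟨e'⟩⟩ := hc
    obtain ⟨X', hX', ⟨e''⟩⟩ := (hS _).1 hZ'
    exact ObjectProperty.trW.mk A hT (prop_of_iso_Q_obj hBA hA (e'' ≪≫ e'.symm) hX')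

end Verdier

/-! ### Both kinds of comparison reduce to equality of the kernels. -/

variable (R : Type u) [Ring R]

/-- Some zero morphism out of `X` has an `n`-exact cone. Applying `Hom(M, -)` makes it a
quasi-isomorphism, and a zero map that is invertible on homology forces the homology of `Hom(M, X)`
to vanish. -/
lemma nExactB_of_isZero_Q_obj (s : Bdd) (n : ℕ∞) (X : KB R s)
    (hX : IsZero ((VQuot.Q (nExactB R s n)).obj X)) : nExactB R s n X := by
  obtain ⟨Y, hY⟩ := exists_trW_zero_of_isZero_Q_obj _ hX
  refine (nExactK_iff R n _).2 fun M hM => ?_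
  have h : (nExactK R n).trW ((bddProp R s).ι.map (0 : X ⟶ Y)) :=
    (ObjectProperty.inverseImage_trW_iff (nExactK R n) (bddProp R s).ι _).1 hY
  have hle : nExactK R n ≤
      (HomotopyCategory.subcategoryAcyclic AddCommGrpCat.{u}).inverseImage (homK R M) :=
    fun Z hZ => (nExactK_iff R n Z).1 hZ M hM
  have h' := (ObjectProperty.inverseImage_trW_iff _ (homK R M) _).1
    (ObjectProperty.trW_monotone hle _ h)
  rw [← HomotopyCategory.quasiIso_eq_trW_subcategoryAcyclic] at h'
  refine (HomotopyCategory.mem_subcategoryAcyclic_iff _).2 fun i => ?_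
  have := h' i
  rw [Functor.map_zero, Functor.map_zero, Functor.map_zero] at this
  rw [IsZero.iff_id_eq_zero, ← cancel_mono (0 : _ ⟶ (HomotopyCategory.homologyFunctor
    AddCommGrpCat.{u} _ i).obj ((homK R M).obj ((bddProp R s).ι.obj Y)))]
  simp

lemma dEquivQuot (s : Bdd) {n m : ℕ∞} (h : n ≤ m) : DEquivQuot R s h := by
  have : (VQuot.Q (nExactB R s m) ⋙ VQuot.Q (KSub R s h)).IsLocalization (nExactB R s n).trW := by
    refine isLocalization_comp_Q (nExactB_anti R s h) (nExactB_of_isZero_Q_obj R s n) _ fun Z => ?_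
    let A := nExactB R s n
    let B := nExactB R s m
    let e := CatCommSq.iso (A.triangulatedLocalizerMorphism B).functor
      (VQuot.Q (B.inverseImage A.ι)) (VQuot.Q B) (KQtoD R s n m)
    -- Every object of `K_{n,m}` comes from an `n`-exact complex, so `KSub` consists of the objects
    -- isomorphic to images of such complexes.
    have := Localization.essSurj (VQuot.Q (B.inverseImage A.ι)) (B.inverseImage A.ι).trW
    constructor
    · rintro ⟨Y, ⟨i⟩⟩
      let X := (VQuot.Q (B.inverseImage A.ι)).objPreimage Y
      exact ⟨X.obj, X.property, ⟨e.app X ≪≫ (KQtoD R s n m).mapIso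
        ((VQuot.Q (B.inverseImage A.ι)).objObjPreimageIso Y) ≪≫ i⟩⟩
    · rintro ⟨X, hX, ⟨i⟩⟩
      exact ⟨_, ⟨(e.app ⟨X, hX⟩).symm ≪≫ i⟩⟩
  exact triangleEquivUnder_of_isLocalization (nExactB R s n).trW _ _

/-- An `n`-exact complex passes to `D_m` through `K_{n,m}`; if the latter is zero, the complex dies
in `D_m`, hence is `m`-exact. -/
lemma kQZero_iff (s : Bdd) {n m : ℕ∞} (h : n ≤ m) :
    KQZero R s n m ↔ nExactB R s n = nExactB R s m := by
  let A := nExactB R s n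
  let B := nExactB R s m
  have := KQtoD_full R s h
  have := KQtoD_faithful R s h
  have := Localization.essSurj (VQuot.Q (B.inverseImage A.ι)) (B.inverseImage A.ι).trW
  let e := CatCommSq.iso (A.triangulatedLocalizerMorphism B).functor
      (VQuot.Q (B.inverseImage A.ι)) (VQuot.Q B) (KQtoD R s n m)
  constructor
  · intro h0
    refine le_antisymm (fun X hX => nExactB_of_isZero_Q_obj R s m X ?_) (nExactB_anti R s h)
    exact ((KQtoD R s n m).map_isZero (h0 ((VQuot.Q (B.inverseImage A.ι)).obj ⟨X, hX⟩))).of_iso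
      (e.app ⟨X, hX⟩)
  · intro h0 Y
    let X := (VQuot.Q (B.inverseImage A.ι)).objPreimage Y
    exact (isZero_Q_obj (B.inverseImage A.ι) (X := X) (h0.le _ X.property)).of_iso
      ((VQuot.Q (B.inverseImage A.ι)).objObjPreimageIso Y).symm

/-- The equivalence sends the image of an `n`-exact complex to zero and is faithful, so that image
is already zero in `D_m`. -/
lemma dNatEquiv_iff (s : Bdd) {n m : ℕ∞} (h : n ≤ m) :
    DNatEquiv R s m n ↔ nExactB R s n = nExactB R s m := by
  constructor
  · rintro ⟨F, _, e, _, _, _⟩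
    refine le_antisymm (fun X hX => nExactB_of_isZero_Q_obj R s m X ?_) (nExactB_anti R s h)
    have h0 : IsZero (F.obj ((VQuot.Q (nExactB R s m)).obj X)) :=
      (isZero_Q_obj _ hX).of_iso (e.app X)
    rw [IsZero.iff_id_eq_zero] at h0 ⊢
    exact F.map_injective (by rw [F.map_id, h0, F.map_zero])
  · intro h0
    have : (VQuot.Q (nExactB R s n)).IsLocalization (nExactB R s m).trW := by
      rw [← h0]
      infer_instance
    exact triangleEquivUnder_of_isLocalization (nExactB R s m).trW _ _

end RelDer

namespace RelDer

/-! ### Finite projective resolutions and the little finitistic dimension. -/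

section Resolutions

variable {R : Type u} [Ring R]

lemma HasFinProjRes.mono {k l : ℕ} (h : k ≤ l) {M : ModuleCat.{u} R} (hM : HasFinProjRes k M) :
    HasFinProjRes l M := by
  obtain ⟨P, d, ε, h₁, h₂, h₃⟩ := hM
  exact ⟨P, d, ε, h₁, fun i hi => h₂ i (h.trans_lt hi), h₃⟩

lemma HasFinProjRes.of_iso {k : ℕ} {M N : ModuleCat.{u} R} (e : M ≅ N) (hM : HasFinProjRes k M) :
    HasFinProjRes k N := by
  obtain ⟨P, d, ε, h₁, h₂, h₃, h₄, h₅⟩ := hM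
  refine ⟨P, d, ε ≫ e.hom, h₁, h₂, ?_, ?_, h₅⟩
  · exact e.toLinearEquiv.surjective.comp h₃
  · intro x
    rw [← h₄ x]
    exact e.toLinearEquiv.map_eq_zero_iff

lemma InP.of_iso {n : ℕ∞} {M N : ModuleCat.{u} R} (e : M ≅ N) (hM : InP n M) : InP n N := by
  obtain ⟨k, hk, hM⟩ := hM
  exact ⟨k, hk, hM.of_iso e⟩

lemma HasFinProjRes.finite {k : ℕ} {M : ModuleCat.{u} R} (hM : HasFinProjRes k M) :
    Module.Finite R M := by
  obtain ⟨P, d, ε, h₁, -, h₃, -⟩ := hM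
  have := (h₁ 0).1
  exact Module.Finite.of_surjective ε.hom h₃

lemma HasFinProjRes.projective {M : ModuleCat.{u} R} (hM : HasFinProjRes 0 M) :
    Module.Projective R M := by
  obtain ⟨P, d, ε, h₁, h₂, h₃, h₄, -⟩ := hM
  have := (h₁ 0).2
  have := h₂ 1 one_pos
  refine Module.Projective.of_equiv (LinearEquiv.ofBijective ε.hom ⟨?_, h₃⟩)
  rw [injective_iff_map_eq_zero]
  intro x hx
  obtain ⟨y, rfl⟩ := (h₄ x).1 hx
  rw [Subsingleton.elim y 0, map_zero]

/-- Splicing a finitely generated projective module onto a resolution. -/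
lemma HasFinProjRes.cons {k : ℕ} {S : ShortComplex (ModuleCat.{u} R)} (hS : S.ShortExact)
    [Module.Finite R S.X₂] [Module.Projective R S.X₂] (h : HasFinProjRes k S.X₁) :
    HasFinProjRes (k + 1) S.X₃ := by
  obtain ⟨P, d, ε, h₁, h₂, h₃, h₄, h₅⟩ := h
  let P' : ℕ → ModuleCat.{u} R := fun i => match i with
    | 0 => S.X₂
    | i + 1 => P i
  let d' : ∀ i, P' (i + 1) ⟶ P' i := fun i => match i with
    | 0 => ε ≫ S.f
    | i + 1 => d i
  refine ⟨P', d', S.g, fun i => ?_, fun i hi => ?_, hS.moduleCat_surjective_g, fun x => ?_,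
    fun i => ?_⟩
  · match i with
    | 0 => exact ⟨‹_›, ‹_›⟩
    | i + 1 => exact h₁ i
  · match i with
    | 0 => exact absurd hi (by simp)
    | i + 1 => exact h₂ i (by simpa using hi)
  · constructor
    · intro hx
      obtain ⟨y, rfl⟩ := (ShortComplex.moduleCat_exact_iff _).1 hS.exact x hx
      obtain ⟨z, rfl⟩ := h₃ y
      exact ⟨z, rfl⟩
    · rintro ⟨z, rfl⟩
      exact congr($(S.zero) (ε z))
  · match i with
    | 0 =>
      intro x
      rw [← h₄ x]
      exact map_eq_zero_iff S.f.hom hS.moduleCat_injective_f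
    | i + 1 => exact h₅ i

lemma hasFinProjRes_zero (M : ModuleCat.{u} R) [Module.Finite R M] [Module.Projective R M] :
    HasFinProjRes 0 M := by
  let P : ℕ → ModuleCat.{u} R := fun i => match i with
    | 0 => M
    | _ + 1 => ModuleCat.of R PUnit
  have hP (i : ℕ) : Subsingleton (P (i + 1)) := inferInstanceAs (Subsingleton PUnit)
  refine ⟨P, fun i => 0, 𝟙 _, fun i => ?_, fun i hi => ?_, fun x => ⟨x, rfl⟩,
    fun x => ⟨fun hx => ⟨0, ?_⟩, ?_⟩, fun i x => ⟨fun _ => ⟨0, Subsingleton.elim _ _⟩,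
      fun _ => rfl⟩⟩
  · match i with
    | 0 => exact ⟨‹_›, ‹_›⟩
    | _ + 1 => exact ⟨inferInstanceAs (Module.Finite R PUnit.{u + 1}),
        inferInstanceAs (Module.Projective R PUnit.{u + 1})⟩
  · match i with
    | 0 => exact absurd hi (lt_irrefl 0)
    | i + 1 => exact hP i
  · simpa using hx.symm
  · rintro ⟨y, rfl⟩
    rfl

lemma HasFinProjRes.exists_shortExact {k : ℕ} {M : ModuleCat.{u} R}
    (hM : HasFinProjRes (k + 1) M) :
    ∃ S : ShortComplex (ModuleCat.{u} R), S.ShortExact ∧ Module.Finite R S.X₂ ∧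
      Module.Projective R S.X₂ ∧ HasFinProjRes k S.X₁ ∧ S.X₃ = M := by
  obtain ⟨P, d, ε, h₁, h₂, h₃, h₄, h₅⟩ := hM
  refine ⟨_, LinearMap.shortExact_shortComplexKer h₃, (h₁ 0).1, (h₁ 0).2,
    ⟨fun i => P (i + 1), fun i => d (i + 1), ModuleCat.ofHom ((d 0).hom.codRestrict
    (LinearMap.ker ε.hom) fun x => (h₄ _).2 ⟨x, rfl⟩), fun i => h₁ (i + 1),
    fun i hi => h₂ (i + 1) (by simpa using hi), ?_, ?_, fun i => h₅ (i + 1)⟩, rfl⟩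
  · rintro ⟨x, hx⟩
    obtain ⟨y, rfl⟩ := (h₄ x).1 hx
    exact ⟨y, rfl⟩
  · intro x
    rw [← h₅ 0 x]
    exact Subtype.ext_iff

lemma HasFinProjRes.hasProjectiveDimensionLE {k : ℕ} {M : ModuleCat.{u} R}
    (hM : HasFinProjRes k M) : HasProjectiveDimensionLE M k := by
  induction k generalizing M with
  | zero =>
    have := hM.projective
    exact (projective_iff_hasProjectiveDimensionLE_zero _).1
      M.projective_of_categoryTheory_projective
  | succ k ih =>
    obtain ⟨S, hS, _, _, h, rfl⟩ := hM.exists_shortExact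
    have : Projective S.X₂ := (IsProjective.iff_projective _).1 ‹_›
    exact (hS.hasProjectiveDimensionLT_X₃_iff k this).2 (ih h)

/-- A resolution by finitely generated projectives can be shortened to the projective dimension. -/
lemma HasFinProjRes.of_hasProjectiveDimensionLE {k n : ℕ} {M : ModuleCat.{u} R}
    (hM : HasFinProjRes k M) (h : HasProjectiveDimensionLE M n) : HasFinProjRes n M := by
  induction n generalizing M k with
  | zero =>
    have := hM.finite
    have := (IsProjective.iff_projective _).2 ((projective_iff_hasProjectiveDimensionLE_zero _).2 h)
    exact hasFinProjRes_zero M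
  | succ n ih =>
    -- Lengthening the resolution by one makes a syzygy sequence available even for `k = 0`; the
    -- syzygy has projective dimension at most `n`.
    obtain ⟨S, hS, _, _, h', rfl⟩ := (hM.mono k.le_succ).exists_shortExact
    have : Projective S.X₂ := (IsProjective.iff_projective _).1 ‹_›
    exact (ih h' ((hS.hasProjectiveDimensionLT_X₃_iff n this).1 h)).cons hS

lemma lfPD_le_iff (n : ℕ) : lfPD R ≤ ((n : ℕ∞) : WithBot ℕ∞) ↔
    ∀ (k : ℕ) (M : ModuleCat.{u} R), HasFinProjRes k M → HasFinProjRes n M := by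
  refine iSup_le_iff.trans ⟨fun h k M hM => ?_, fun h M => ?_⟩
  · exact hM.of_hasProjectiveDimensionLE ((projectiveDimension_le_iff _ _).1 (h ⟨M, k, hM⟩))
  · obtain ⟨M, k, hM⟩ := M
    exact (projectiveDimension_le_iff _ _).2 (h k M hM).hasProjectiveDimensionLE

/-- By induction the first syzygy has a resolution of length `n`, so the module has one of length `n
+ 1`, which `h` shortens. -/
lemma lfPD_le_of_succ (n : ℕ)
    (h : ∀ M : ModuleCat.{u} R, HasFinProjRes (n + 1) M → HasFinProjRes n M) :
    lfPD R ≤ ((n : ℕ∞) : WithBot ℕ∞) := by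
  rw [lfPD_le_iff]
  intro k
  induction k with
  | zero => exact fun M hM => hM.mono n.zero_le
  | succ k ih =>
    intro M hM
    obtain ⟨S, hS, _, _, h', rfl⟩ := hM.exists_shortExact
    exact h _ ((ih _ h').cons hS)

lemma nExactB_eq_of_lfPD_le (s : Bdd) {n : ℕ} (h : lfPD R ≤ ((n : ℕ∞) : WithBot ℕ∞)) {m : ℕ∞}
    (hm : (n : ℕ∞) ≤ m) : nExactB R s n = nExactB R s m := by
  refine le_antisymm (fun X hX => ?_) (nExactB_anti R s hm)
  refine (isNExact_iff _ _).2 fun M hM => (isNExact_iff _ _).1 hX M ?_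
  obtain ⟨k, -, hM⟩ := hM
  exact ⟨n, by exact_mod_cast n.lt_succ_self, (lfPD_le_iff n).1 h k M hM⟩

end Resolutions

/-! ### Projective dimension of retracts of finite sums. -/

section ProjectiveDimension

variable {A : Type*} [Category* A] [Abelian A]

/-- An object whose identity is a sum of morphisms factoring through objects of projective
dimension `< n` has projective dimension `< n`. -/
lemma hasProjectiveDimensionLT_of_id_eq_sum {ι : Type*} [Fintype ι] {M : A} (N : ι → A)
    (a : ∀ i, M ⟶ N i) (b : ∀ i, N i ⟶ M) (h : ∑ i, a i ≫ b i = 𝟙 M) (n : ℕ)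
    (hN : ∀ i, HasProjectiveDimensionLT (N i) n) : HasProjectiveDimensionLT M n := by
  let := HasExt.standard A
  rw [hasProjectiveDimensionLT_iff]
  intro i hi Y e
  -- `𝟙 M` acts on `Ext^i(M, Y)` as a sum of maps factoring through the groups `Ext^i(N j, Y) = 0`.
  have key : (Abelian.Ext.mk₀ (𝟙 M)).comp e (zero_add i) = 0 := by
    rw [← h, Abelian.Ext.mk₀_sum, Abelian.Ext.sum_comp]
    refine Finset.sum_eq_zero fun j _ => ?_
    rw [← Abelian.Ext.mk₀_comp_mk₀_assoc,
      Abelian.Ext.eq_zero_of_hasProjectiveDimensionLT ((Abelian.Ext.mk₀ (b j)).comp e _) n hi,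
      Abelian.Ext.comp_zero]
  simpa using key

end ProjectiveDimension

/-! ### Short exact sequences as bounded complexes. -/

section ThreeTerm

variable {R : Type u} [Ring R] (S : ShortComplex (ModuleCat.{u} R))

/-- The terms of the complex given by a short complex placed in degrees `0`, `1`, `2`. -/
noncomputable def threeTermX : ℤ → ModuleCat.{u} R
  | .ofNat 0 => S.X₁
  | .ofNat 1 => S.X₂
  | .ofNat 2 => S.X₃
  | _ => 0

/-- The differentials of the complex given by a short complex placed in degrees `0`, `1`, `2`. -/
noncomputable def threeTermD : ∀ i : ℤ, threeTermX S i ⟶ threeTermX S (i + 1)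
  | .ofNat 0 => S.f
  | .ofNat 1 => S.g
  | .ofNat (_ + 2) => 0
  | .negSucc _ => 0

/-- The complex given by a short complex placed in degrees `0`, `1`, `2`. -/
noncomputable def threeTerm : CochainComplex (ModuleCat.{u} R) ℤ :=
  CochainComplex.of (threeTermX S) (threeTermD S) fun i => match i with
    | .ofNat 0 => S.zero
    | .ofNat 1 => comp_zero
    | .ofNat (_ + 2) => zero_comp
    | .negSucc _ => zero_comp

lemma threeTerm_d₀₁ : (threeTerm S).d 0 1 = S.f :=
  CochainComplex.of_d (threeTermX S) (threeTermD S) 0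

lemma threeTerm_d₁₂ : (threeTerm S).d 1 2 = S.g :=
  CochainComplex.of_d (threeTermX S) (threeTermD S) 1

lemma isZero_threeTerm_X (i : ℤ) (hi : i < 0 ∨ 2 < i) : IsZero ((threeTerm S).X i) := by
  match i with
  | .ofNat 0 | .ofNat 1 | .ofNat 2 => simp at hi
  | .ofNat (_ + 3) => exact isZero_zero _
  | .negSucc _ => exact isZero_zero _

lemma holds_threeTerm (s : Bdd) : s.Holds (threeTerm S) := by
  have h₁ : (threeTerm S).IsStrictlyGE 0 :=
    (CochainComplex.isStrictlyGE_iff _ _).2 fun i hi => isZero_threeTerm_X S i (.inl hi)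
  have h₂ : (threeTerm S).IsStrictlyLE 2 :=
    (CochainComplex.isStrictlyLE_iff _ _).2 fun i hi => isZero_threeTerm_X S i (.inr hi)
  cases s
  exacts [trivial, ⟨0, h₁⟩, ⟨2, h₂⟩, ⟨⟨0, h₁⟩, 2, h₂⟩]

/-- `Hom(M, -)` is left exact, so only degree `2` imposes a condition. -/
lemma isNExact_threeTerm_iff (hS : S.ShortExact) (n : ℕ∞) :
    IsNExact n (threeTerm S) ↔ ∀ M, InP n M → ∀ f : M ⟶ S.X₃, ∃ g : M ⟶ S.X₂, g ≫ S.g = f := by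
  have := hS.mono_f
  refine (isNExact_iff _ _).trans (forall_congr' fun M => forall_congr' fun _ => ?_)
  constructor
  · intro h f
    obtain ⟨g, hg⟩ := (homCx_exactAt_iff M (threeTerm S) 1 2 3 rfl rfl).1 (h 2) f
      ((isZero_threeTerm_X S 3 (.inr (by simp))).eq_of_tgt _ _)
    rw [threeTerm_d₁₂] at hg
    exact ⟨g, hg⟩
  · intro h i
    rw [homCx_exactAt_iff M (threeTerm S) (i - 1) i (i + 1) (by simp) rfl]
    intro f hf
    by_cases hi : i < 0 ∨ 2 < i
    · exact ⟨0, (isZero_threeTerm_X S i hi).eq_of_tgt _ _⟩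
    obtain rfl | rfl | rfl : i = 0 ∨ i = 1 ∨ i = 2 := by lia
    · have hf' : (show M ⟶ S.X₁ from f) ≫ S.f = 0 := by rw [← threeTerm_d₀₁]; exact hf
      exact ⟨0, by rw [zero_comp]; exact (zero_of_comp_mono _ hf').symm⟩
    · have hf' : (show M ⟶ S.X₂ from f) ≫ S.g = 0 := by rw [← threeTerm_d₁₂]; exact hf
      refine ⟨hS.exact.lift _ hf', ?_⟩
      change _ ≫ (threeTerm S).d 0 1 = _
      rw [threeTerm_d₀₁]
      exact hS.exact.lift_f _ hf'
    · obtain ⟨g, hg⟩ := h f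
      refine ⟨g, ?_⟩
      change _ ≫ (threeTerm S).d 1 2 = _
      rw [threeTerm_d₁₂]
      exact hg

/-- Three-term complexes are bounded, so they test the equality of kernels for all four decorations
at once. -/
lemma lift_of_nExactB_eq (s : Bdd) {n m : ℕ∞} (h : nExactB R s n = nExactB R s m)
    (hS : S.ShortExact)
    (hn : ∀ M, InP n M → ∀ f : M ⟶ S.X₃, ∃ g : M ⟶ S.X₂, g ≫ S.g = f)
    {M : ModuleCat.{u} R} (hM : InP m M) (f : M ⟶ S.X₃) : ∃ g : M ⟶ S.X₂, g ≫ S.g = f := by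
  let X : KB R s := ⟨(HomotopyCategory.quotient _ _).obj (threeTerm S), holds_threeTerm S s⟩
  have hX : nExactB R s n X := (isNExact_threeTerm_iff S hS n).2 hn
  rw [h] at hX
  exact (isNExact_threeTerm_iff S hS m).1 hX M hM f

end ThreeTerm

/-! ### Morphisms out of direct sums. -/

section SumMap

variable {R : Type u} [Ring R] {J : Type u} {N : J → ModuleCat.{u} R} {M : ModuleCat.{u} R}

/-- The morphism from a direct sum given by its components. -/
noncomputable def sumMap (f : ∀ j, N j ⟶ M) :
    ModuleCat.of R (DirectSum J fun j => N j) ⟶ M :=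
  open scoped Classical in ModuleCat.ofHom (DirectSum.toModule R _ _ fun j => (f j).hom)

lemma sumMap_lof [inst : DecidableEq J] (f : ∀ j, N j ⟶ M) (j : J) (x : N j) :
    sumMap f (DirectSum.lof R J (fun j => N j) j x) = f j x := by
  obtain rfl : inst = fun a b => Classical.propDecidable (a = b) := Subsingleton.elim _ _
  open scoped Classical in exact DirectSum.toModule_lof ..

/-- A section of a morphism from a direct sum to a finitely generated module involves only
finitely many summands. -/
lemma exists_id_eq_sum_of_section [Module.Finite R M] (f : ∀ j, N j ⟶ M)
    (g : M ⟶ ModuleCat.of R (DirectSum J fun j => N j))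
    (hg : g ≫ sumMap f = 𝟙 M) :
    ∃ (t : Finset J) (a : ∀ j : t, M ⟶ N j), ∑ j, a j ≫ f j = 𝟙 M := by
  classical
  obtain ⟨G, hG⟩ := Module.Finite.fg_top (R := R) (M := M)
  let supp (x : M) : Finset J := DFinsupp.support (g x)
  -- Take the summands met by the images of a finite generating set; the two endomorphisms then need
  -- comparing only on generators.
  refine ⟨G.biUnion supp, fun j => g ≫ ModuleCat.ofHom (DirectSum.component R _ _ j.1), ?_⟩
  refine ModuleCat.hom_ext (LinearMap.ext_on hG fun x hx => ?_)
  conv_rhs => rw [← hg]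
  have hx' : sumMap f (g x) = ∑ j ∈ supp x, f j (g x j) := by
    conv_lhs => rw [← DirectSum.sum_support_of (g x), map_sum]
    exact Finset.sum_congr rfl fun j _ => sumMap_lof f j _
  change _ = sumMap f (g x)
  rw [hx', Finset.sum_subset (Finset.subset_biUnion_of_mem supp hx) fun j _ hj => ?_]
  · simp only [ModuleCat.hom_sum, LinearMap.sum_apply]
    exact Finset.sum_coe_sort _ fun j => f j (g x j)
  · rw [DFinsupp.notMem_support_iff.1 hj, map_zero]

end SumMap

/-! ### Covers by modules in `𝒫^{<n+1}`. -/

section Cover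

variable (R : Type u) [Ring R] (n : ℕ∞)

/-- A small set of representatives of the modules in `𝒫^{<n+1}`, given by presentations. -/
abbrev Rep : Type u :=
  Σ k : ℕ, {L : Submodule R (Fin k → R) // InP n (ModuleCat.of R ((Fin k → R) ⧸ L))}

variable {R n}

/-- The module presented by `i`. -/
abbrev Rep.module (i : Rep R n) : ModuleCat.{u} R := ModuleCat.of R ((Fin i.1 → R) ⧸ i.2.1)

/-- Modules in the class are finitely generated, hence quotients of some `R^l`. Such quotients are
indexed by a type in universe `u`, so the direct sum in `coverMap` stays in `ModuleCat.{u} R`. -/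
lemma InP.exists_rep {M : ModuleCat.{u} R} (hM : InP n M) :
    ∃ i : Rep R n, Nonempty (M ≅ i.module) := by
  obtain ⟨k, -, hM'⟩ := id hM
  have := hM'.finite
  obtain ⟨l, p, hp⟩ := Module.Finite.exists_fin' R M
  let e : M ≅ ModuleCat.of R ((Fin l → R) ⧸ LinearMap.ker p) :=
    (p.quotKerEquivOfSurjective hp).symm.toModuleIso
  exact ⟨⟨l, LinearMap.ker p, hM.of_iso e⟩, ⟨e⟩⟩

variable (n)

/-- The canonical map to `M` from the direct sum of the sources of all maps to `M` from
representatives of `𝒫^{<n+1}`. -/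
noncomputable abbrev coverMap (M : ModuleCat.{u} R) :
    ModuleCat.of R (DirectSum (Σ i : Rep R n, i.module ⟶ M) fun j => j.1.module) ⟶ M :=
  sumMap (N := fun j : Σ i : Rep R n, i.module ⟶ M => j.1.module) fun j => j.2

/-- Transported to a representative, `f` is itself one of the indices, and the inclusion of that
summand lifts it. -/
lemma exists_comp_coverMap {M N : ModuleCat.{u} R} (hN : InP n N) (f : N ⟶ M) :
    ∃ g : N ⟶ ModuleCat.of R (DirectSum (Σ i : Rep R n, i.module ⟶ M) fun j => j.1.module),
      g ≫ coverMap n M = f := by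
  classical
  obtain ⟨i, ⟨e⟩⟩ := hN.exists_rep
  let j : Σ i : Rep R n, i.module ⟶ M := ⟨i, e.inv ≫ f⟩
  refine ⟨e.hom ≫ ModuleCat.ofHom (DirectSum.lof R (Σ i : Rep R n, i.module ⟶ M)
    (fun j => j.1.module) j), ModuleCat.hom_ext (LinearMap.ext fun x => ?_)⟩
  exact (sumMap_lof (N := fun j : Σ i : Rep R n, i.module ⟶ M => j.1.module) (fun j => j.2) j
    (e.hom x)).trans congr($(e.hom_inv_id_assoc f) x)

/-- `R` lies in the class, so the map `R ⟶ M` sending `1` to `x` lifts. -/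
lemma coverMap_surjective (M : ModuleCat.{u} R) : Function.Surjective (coverMap n M) := by
  intro x
  obtain ⟨g, hg⟩ := exists_comp_coverMap n (inP_self n)
    (ModuleCat.ofHom (LinearMap.toSpanSingleton R M x))
  refine ⟨g (1 : R), ?_⟩
  simpa using congr($hg (1 : R))

end Cover

/-! ### Equality of kernels bounds the finitistic dimension. -/

variable (R : Type u) [Ring R]

lemma lfPD_le_of_nExactB_eq (s : Bdd) (n : ℕ) {m : ℕ∞} (hm : (n : ℕ∞) < m)
    (h : nExactB R s n = nExactB R s m) : lfPD R ≤ ((n : ℕ∞) : WithBot ℕ∞) := by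
  refine lfPD_le_of_succ n fun M hM => ?_
  have hM' : InP m M := ⟨n + 1, by
    simpa using (ENat.add_lt_add_iff_right (ENat.natCast_ne_top 1)).2 hm, hM⟩
  have := hM.finite
  let S : ShortComplex (ModuleCat.{u} R) := (coverMap (n : ℕ∞) M).hom.shortComplexKer
  -- The cover is `n`-exact by construction, hence `m`-exact; as `M` lies in `𝒫^{<m+1}`, the cover
  -- splits.
  obtain ⟨g, hg⟩ := lift_of_nExactB_eq S s h
    (LinearMap.shortExact_shortComplexKer (coverMap_surjective n M))
    (fun N hN f => exists_comp_coverMap (M := M) n hN f) hM' (𝟙 M)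
  obtain ⟨t, a, ha⟩ := exists_id_eq_sum_of_section _ g hg
  refine hM.of_hasProjectiveDimensionLE
    -- Projective dimension at most `n` is encoded as less than `n + 1`.
    (hasProjectiveDimensionLT_of_id_eq_sum _ a _ ha (n + 1) fun j => ?_)
  obtain ⟨k, hk, hN⟩ := j.1.1.2.2
  have hk' : k ≤ n := by
    have : k < n + 1 := by exact_mod_cast hk
    lia
  exact (hN.mono hk').hasProjectiveDimensionLE

end RelDer

theorem theorem5p3 (R : Type u) [Ring R] (s : RelDer.Bdd) :
    (∀ (n m : ℕ∞) (h : n ≤ m), RelDer.DEquivQuot R s h) ∧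
    ∀ n : ℕ,
      [RelDer.lfPD R ≤ ((n : ℕ∞) : WithBot ℕ∞),
        ∀ m : ℕ∞, (n : ℕ∞) < m → RelDer.KQZero R s n m,
        ∃ m : ℕ∞, (n : ℕ∞) < m ∧ RelDer.KQZero R s n m,
        ∀ m : ℕ∞, (n : ℕ∞) < m → RelDer.DNatEquiv R s m n,
        ∃ m : ℕ∞, (n : ℕ∞) < m ∧ RelDer.DNatEquiv R s m n].TFAE := by
  refine ⟨fun n m h => RelDer.dEquivQuot R s h, fun n => ?_⟩
  tfae_have 1 → 2 := fun h m hm =>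
    (RelDer.kQZero_iff R s hm.le).2 (RelDer.nExactB_eq_of_lfPD_le s h hm.le)
  -- `m = ∞` always exceeds the natural number `n`.
  tfae_have 2 → 3 := fun h => ⟨⊤, ENat.natCast_lt_top n, h _ (ENat.natCast_lt_top n)⟩
  tfae_have 3 → 1 := fun ⟨m, hm, h⟩ =>
    RelDer.lfPD_le_of_nExactB_eq R s n hm ((RelDer.kQZero_iff R s hm.le).1 h)
  tfae_have 1 → 4 := fun h m hm =>
    (RelDer.dNatEquiv_iff R s hm.le).2 (RelDer.nExactB_eq_of_lfPD_le s h hm.le)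
  tfae_have 4 → 5 := fun h => ⟨⊤, ENat.natCast_lt_top n, h _ (ENat.natCast_lt_top n)⟩
  tfae_have 5 → 1 := fun ⟨m, hm, h⟩ =>
    RelDer.lfPD_le_of_nExactB_eq R s n hm ((RelDer.dNatEquiv_iff R s hm.le).1 h)
  tfae_finish
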